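/- An edge-ordered graph is a finite simple graph together with a linear order on its edge set; a subgraph inherits the edge-order, and isomorphisms must respect it. An edge-ordered graph $G$ contains an edge-ordered graph $H$ if $H$ is isomorphic to a (not necessarily induced) subgraph of $G$; otherwise $G$ avoids $H$. If $H$ has at least one edge, $\mathrm{ex}_<(n,H)$ denotes the maximal number of edges in an edge-ordered graph on $n$ vertices that avoids $H$. The order chromatic number of $H$ is the smallest chromatic number of a finite simple graph $G$ such that every edge-ordering of $G$ contains $H$, and it is $\infty$ if there is no such $G$. Theorem. Let $H$ be an edge-ordered forest, that is, an edge-ordered graph whose underlying simple graph is a forest, and suppose that $H$ has order chromatic number $2$. Then $\mathrm{ex}_<(n,H)\le n\cdot 2^{O(\sqrt{\log n})}$; that is, there is a constant $C>0$, depending only on $H$, such that $\mathrm{ex}_<(n,H)\le n\cdot 2^{C\sqrt{\log_2 n}}$ for every integer $n\ge 1$. -/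

import Mathlib

/-- An edge-ordered graph on the vertex type `V`: a simple graph together with a linear order on its
set of edges. Finiteness of `V` is assumed where it is needed. -/
structure EdgeOrderedGraph (V : Type*) where
  /-- The underlying simple graph. -/
  graph : SimpleGraph V
  /-- The edge-order. -/
  order : LinearOrder graph.edgeSet

namespace EdgeOrderedGraph

/-- `G.Contains H`: the edge-ordered graph `H` is isomorphic to a (not necessarily induced) subgraph
of `G` with the inherited edge-order, that is, there is a copy of the graph underlying `H` in the
graph underlying `G` along which the edge-order is preserved. -/
def Contains {V W : Type*} (G : EdgeOrderedGraph V) (H : EdgeOrderedGraph W) : Prop :=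
  ∃ f : SimpleGraph.Copy H.graph G.graph, ∀ e e' : H.graph.edgeSet,
    H.order.lt e e' → G.order.lt (f.mapEdgeSet e) (f.mapEdgeSet e')

/-- `G` avoids `H` if it does not contain `H`. -/
def Avoids {V W : Type*} (G : EdgeOrderedGraph V) (H : EdgeOrderedGraph W) : Prop :=
  ¬ G.Contains H

/-- The simple graph `G` can avoid the edge-ordered graph `H` if some edge-ordering of `G`
avoids `H`. -/
def CanAvoid {V W : Type*} (G : SimpleGraph V) (H : EdgeOrderedGraph W) : Prop :=
  ∃ L : LinearOrder G.edgeSet, (EdgeOrderedGraph.mk G L).Avoids H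

/-- The order chromatic number of `H`: the smallest chromatic number of a finite simple graph that
cannot avoid `H` (all of whose edge-orderings contain `H`), and infinity (`⊤`) if every finite
simple graph can avoid `H`. -/
noncomputable def orderChromaticNumber {W : Type*} (H : EdgeOrderedGraph W) : ℕ∞ :=
  sInf {c : ℕ∞ | ∃ (N : ℕ) (G : SimpleGraph (Fin N)), ¬ CanAvoid G H ∧ c = G.chromaticNumber}

/-- The numbers of edges of the edge-ordered graphs on `n` vertices that avoid `H`. -/
def avoidingEdgeCounts {W : Type*} (n : ℕ) (H : EdgeOrderedGraph W) : Set ℕ :=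
  {m : ℕ | ∃ G : EdgeOrderedGraph (Fin n), G.Avoids H ∧ m = G.graph.edgeSet.ncard}

/-- The Turán number of the edge-ordered graph `H`: the maximal number of edges in an edge-ordered
graph on `n` vertices that avoids `H`. It is meaningful if `H` has at least one edge. -/
noncomputable def turanNumber {W : Type*} (n : ℕ) (H : EdgeOrderedGraph W) : ℕ :=
  sSup (avoidingEdgeCounts n H)

/-- If `H` has an edge, the supremum that defines the Turán number is a maximum. -/
theorem isGreatest_turanNumber {W : Type*} (n : ℕ) (H : EdgeOrderedGraph W)
    (hH : H.graph.edgeSet.Nonempty) :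
    IsGreatest (avoidingEdgeCounts n H) (turanNumber n H) := by
  have hne : (avoidingEdgeCounts n H).Nonempty := by
    have he : IsEmpty (⊥ : SimpleGraph (Fin n)).edgeSet := by
      rw [SimpleGraph.edgeSet_bot]; infer_instance
    refine ⟨_, ⟨⊥, LinearOrder.lift' (β := ℕ) (fun e => (he.false e).elim)
      fun e => (he.false e).elim⟩, ?_, rfl⟩
    rintro ⟨f, -⟩
    exact he.false (f.mapEdgeSet ⟨_, hH.some_mem⟩)
  have hbdd : BddAbove (avoidingEdgeCounts n H) := by
    refine ⟨(Set.univ : Set (Sym2 (Fin n))).ncard, ?_⟩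
    rintro m ⟨G, -, rfl⟩
    exact Set.ncard_le_ncard (Set.subset_univ _) Set.finite_univ
  exact ⟨Nat.sSup_mem hne hbdd, fun m hm => le_csSup hbdd hm⟩

end EdgeOrderedGraph

/-! Order a bipartite graph lexicographically, first by the endpoint in one colour class and then by
the other endpoint. Order chromatic number 2 forces `H` to occur in such an ordering
(`exists_lex_of_orderChromaticNumber_eq_two`). It therefore suffices to find stars around the
vertices of one side of the forest, with different stars in successive intervals of the edge-order
and the leaves of each star in prescribed order.

Such stars are glued one at a time. Some centre of a forest shares at most one neighbour with the
other centres. The other stars are embedded first with leaves in a `core`, where every vertex can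
play any leaf of a new star in any block (`exists_embedding_stars`). Passing to the core loses only
linearly many edges, by double counting (`sum_le_sum_core`). So if there is no copy, the vertices
whose edges spread over `k` blocks carry little weight.

Cut the edge-order into `t` blocks. Every other vertex has a proportion `1 / (2 * k)` of its edges
in a single block (`exists_concentration`). Applying this from both sides keeps a proportion `1 / (4
* k ^ 2)` of the edges, up to a linear error polynomial in `t`. The surviving edges of different
blocks lie between disjoint vertex classes, so the bounds for the blocks add up in a recursion
(`card_le_of_not_hasLexCopy`). Each level divides the maximal edge number by `t` and costs a factor
`4 * k ^ 2 + 1`. With `t = 2 ^ s`, depth `2 * s` and `s` about the square root of `log n`, both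
losses are `2 ^ O(s)`. -/

namespace EdgeOrderedGraph

section

open Finset Function

/-! ### Forests, injections and ranks -/

/-- A nonempty finite acyclic graph has a vertex of degree at most one. -/
theorem exists_forall_adj_eq_of_isAcyclic {W : Type*} [Finite W] [Nonempty W] {Γ : SimpleGraph W}
    (hΓ : Γ.IsAcyclic) : ∃ v, ∀ u w, Γ.Adj v u → Γ.Adj v w → u = w := by
  classical
  have := Fintype.ofFinite W
  have : Finite Γ.edgeSet := inferInstance
  obtain ⟨a, v, p, hp, hmax⟩ := SimpleGraph.Walk.exists_isPath_forall_isPath_length_le_length Γ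
  -- `v` ends a longest path. A neighbour off the path would extend it, and by acyclicity the only
  -- neighbour on it is the penultimate vertex.
  have key : ∀ u, Γ.Adj v u → u = p.penultimate := by
    intro u hu
    refine hΓ.eq_penultimate_of_adj_end hp hu ?_
    by_contra hns
    have := hmax _ _ (p.concat hu) (hp.concat hns hu)
    simp at this
  exact ⟨v, fun u w hu hw => (key u hu).trans (key w hw).symm⟩

/-- In a forest, any nonempty independent set `S` contains a vertex sharing at most one neighbour
with the rest of `S`. -/
theorem exists_forall_common_neighbor_eq {W : Type*} [Finite W] {Γ : SimpleGraph W}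
    (hΓ : Γ.IsAcyclic) {S : Set W} (hS : S.Nonempty) :
    ∃ a ∈ S, ∀ b b', Γ.Adj a b → Γ.Adj a b' → (∃ c ∈ S, c ≠ a ∧ Γ.Adj c b) →
      (∃ c ∈ S, c ≠ a ∧ Γ.Adj c b') → b = b' := by
  -- A shared neighbour has two neighbours in `S`, hence degree at least two in the forest induced
  -- on `T`. A vertex of degree at most one there must lie in `S`.
  let T : Set W := S ∪ {b | ∃ a ∈ S, ∃ c ∈ S, c ≠ a ∧ Γ.Adj a b ∧ Γ.Adj c b}
  have : Nonempty T := ⟨⟨hS.some, Or.inl hS.some_mem⟩⟩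
  obtain ⟨⟨v, hvT⟩, hv⟩ := exists_forall_adj_eq_of_isAcyclic (hΓ.induce T)
  have hv' : ∀ u ∈ T, ∀ w ∈ T, Γ.Adj v u → Γ.Adj v w → u = w := by
    intro u hu w hw h1 h2
    have := hv ⟨u, hu⟩ ⟨w, hw⟩ (by simpa using h1) (by simpa using h2)
    simpa using this
  rcases hvT with hvS | ⟨a, ha, c, hc, hca, h1, h2⟩
  · refine ⟨v, hvS, fun b b' hb hb' h h' => ?_⟩
    obtain ⟨c, hc, hcv, hcb⟩ := h
    obtain ⟨c', hc', hcv', hcb'⟩ := h'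
    exact hv' b (Or.inr ⟨v, hvS, c, hc, hcv, hb, hcb⟩) b' (Or.inr ⟨v, hvS, c', hc', hcv', hb', hcb'⟩)
      hb hb'
  · exact absurd (hv' c (Or.inl hc) a (Or.inl ha) h2.symm h1.symm) hca

/-- An injection on a subset extends to the whole type if the cardinalities allow it. -/
theorem exists_injective_extend {W V : Type*} [Fintype W] [Fintype V]
    (hcard : Fintype.card W ≤ Fintype.card V) {D : Set W} {f : W → V} (hf : Set.InjOn f D) :
    ∃ g : W → V, Injective g ∧ ∀ w ∈ D, g w = f w := by
  classical
  obtain ⟨T, hDT, hT⟩ := Finset.exists_superset_card_eq (s := D.toFinset.image f)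
    (n := Fintype.card W) (Finset.card_image_le.trans (Finset.card_le_univ _)) hcard
  obtain ⟨g, hg⟩ := Set.MapsTo.exists_equiv_extend_of_card_eq (s := D) (f := f) hT.symm
    (fun w hw => hDT (Finset.mem_image_of_mem f (by simpa using hw))) hf
  exact ⟨fun w => g w, Subtype.val_injective.comp g.injective, hg⟩

/-- `Fin k` embeds monotonically into any set of `k` elements carrying an injective key. -/
theorem exists_fin_monotone_key {V : Type*} {k : ℕ} {L : Finset V} {g : V → ℕ}
    (hg : Set.InjOn g L) (hk : k ≤ #L) :
    ∃ f : Fin k → V, (∀ i, f i ∈ L) ∧ ∀ i j, i < j → g (f i) < g (f j) := by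
  classical
  have hk' : k ≤ #(L.image g) := by rwa [Finset.card_image_of_injOn hg]
  have hmem := fun i => Finset.mem_image.1 (Finset.orderEmbOfCardLe_mem (L.image g) hk' i)
  choose f hf hfg using hmem
  refine ⟨f, hf, fun i j hij => ?_⟩
  rw [hfg, hfg]
  simpa using hij

/-- The number of elements of smaller key is strictly increasing in the key. -/
theorem card_filter_key_lt_strictMono {V : Type*} (T : Finset V) (g : V → ℕ) {u w : V}
    (hu : u ∈ T) (huw : g u < g w) : #{z ∈ T | g z < g u} < #{z ∈ T | g z < g w} := by
  classical
  refine Finset.card_lt_card ((Finset.ssubset_iff_of_subset ?_).2 ⟨u, by simp [hu, huw], by simp⟩)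
  intro z
  simp only [mem_filter]
  exact fun hz => ⟨hz.1, hz.2.trans huw⟩

theorem injOn_card_filter_key_lt {V : Type*} (T : Finset V) {g : V → ℕ} (hg : Set.InjOn g T) :
    Set.InjOn (fun y => #{z ∈ T | g z < g y}) T := by
  intro y hy y' hy' he
  rcases lt_trichotomy (g y) (g y') with hlt | heq | hlt
  · exact absurd he (card_filter_key_lt_strictMono T g hy hlt).ne
  · exact hg hy hy' heq
  · exact absurd he.symm (card_filter_key_lt_strictMono T g hy' hlt).ne

/-- At most `h` elements of a finite set have fewer than `h` elements of smaller key. -/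
theorem card_filter_card_key_lt_lt {V : Type*} (T : Finset V) {g : V → ℕ} (hg : Set.InjOn g T)
    (h : ℕ) : #{y ∈ T | #{z ∈ T | g z < g y} < h} ≤ h := by
  have : #{y ∈ T | #{z ∈ T | g z < g y} < h} ≤ #(range h) :=
    Finset.card_le_card_of_injOn (fun y => #{z ∈ T | g z < g y}) (by intro y; simp)
      ((injOn_card_filter_key_lt T hg).mono (Finset.coe_subset.2 (Finset.filter_subset _ _)))
  simpa using this

/-- At most `h` elements of a finite set have fewer than `h` elements of larger key. -/
theorem card_filter_card_lt_key_lt {V : Type*} (T : Finset V) {g : V → ℕ} (hg : Set.InjOn g T)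
    (h : ℕ) : #{y ∈ T | #{z ∈ T | g y < g z} < h} ≤ h := by
  classical
  have hle : ∀ y ∈ T, g y ≤ T.sup g := fun y hy => Finset.le_sup hy
  have hg' : Set.InjOn (fun y => T.sup g - g y) T := by
    intro y hy y' hy' he
    have h1 := hle y hy
    have h2 := hle y' hy'
    dsimp only at he
    exact hg hy hy' (by omega)
  convert card_filter_card_key_lt_lt T hg' h using 6 with y hy z hz
  have h1 := hle y hy
  have h2 := hle z hz
  omega

/-! ### Cores and the embedding of stars -/

/-- The edge `(x, y)` belongs to `P`, and at `x` there are at least `h` smaller and at least `h`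
larger edges of `P` that end in `Y`. -/
def IsInner {V : Type*} (P : Finset (V × V)) (r : V × V → ℕ) (h : ℕ) (Y : Finset V) (x y : V) :
    Prop :=
  (x, y) ∈ P ∧ (∃ L ⊆ Y, h ≤ #L ∧ ∀ z ∈ L, (x, z) ∈ P ∧ r (x, z) < r (x, y)) ∧
    (∃ L ⊆ Y, h ≤ #L ∧ ∀ z ∈ L, (x, z) ∈ P ∧ r (x, y) < r (x, z))

open Classical in
/-- The vertices of `Y` that have, for every `i`, at least `h` inner edges in `P i`. -/
noncomputable def core {V : Type*} [Fintype V] {k : ℕ} (P : Fin k → Finset (V × V))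
    (r : V × V → ℕ) (h : ℕ) (Y : Finset V) : Finset V :=
  {y ∈ Y | ∀ i, h ≤ #{x | IsInner (P i) r h Y x y}}

theorem core_subset {V : Type*} [Fintype V] {k : ℕ} (P : Fin k → Finset (V × V))
    (r : V × V → ℕ) (h : ℕ) (Y : Finset V) : core P r h Y ⊆ Y :=
  Finset.filter_subset _ _

theorem iterate_core_subset {V : Type*} [Fintype V] {k : ℕ} (P : Fin k → Finset (V × V))
    (r : V × V → ℕ) (h j : ℕ) (Y : Finset V) : (core P r h)^[j] Y ⊆ Y := by
  induction j with
  | zero => simp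
  | succ j ih => rw [iterate_succ_apply']; exact (core_subset P r h _).trans ih

/-- Every vertex of the core extends to an ordered star with fresh vertices, in which it plays the
role of any prescribed leaf. -/
theorem exists_star {V W : Type*} [Fintype V] {k : ℕ} {P : Fin k → Finset (V × V)}
    {r : V × V → ℕ} {h : ℕ} {Y : Finset V} (hr : ∀ i, Set.InjOn r (P i)) {U : Finset V}
    (hU : #U + k < h) {pos : W → Fin k} {y₀ : V}
    (hy₀ : y₀ ∈ core P r h Y) (i : Fin k) (b₀ : W) :
    ∃ (x : V) (ψ : W → V), x ∉ U ∧ ψ b₀ = y₀ ∧ (∀ b, ψ b ∈ Y ∧ (x, ψ b) ∈ P i) ∧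
      (∀ b, b ≠ b₀ → ψ b ∉ U) ∧ ∀ b b', pos b < pos b' → r (x, ψ b) < r (x, ψ b') := by
  classical
  obtain ⟨hy₀Y, hy₀'⟩ := Finset.mem_filter.1 hy₀
  obtain ⟨x, hx, hxU⟩ : ∃ x ∈ ({x | IsInner (P i) r h Y x y₀} : Finset V), x ∉ U := by
    apply Finset.exists_mem_notMem_of_card_lt_card
    have := hy₀' i
    omega
  obtain ⟨hxy, ⟨L, hLY, hL, hL'⟩, ⟨M, hMY, hM, hM'⟩⟩ := (Finset.mem_filter.1 hx).2
  -- Since `#U + k < h`, at least `k` elements of `K` avoid `U`.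
  have pick : ∀ K : Finset V, h ≤ #K → (∀ z ∈ K, (x, z) ∈ P i) →
      ∃ f : Fin k → V, (∀ j, f j ∈ K \ U) ∧ ∀ j j', j < j' → r (x, f j) < r (x, f j') := by
    intro K hK hKP
    refine exists_fin_monotone_key (g := fun z => r (x, z)) ?_ ?_
    · intro z hz z' hz' he
      have hz := (Finset.mem_sdiff.1 (Finset.mem_coe.1 hz)).1
      have hz' := (Finset.mem_sdiff.1 (Finset.mem_coe.1 hz')).1
      have := hr i (hKP z hz) (hKP z' hz') he
      simpa using this
    · have := Finset.le_card_sdiff U K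
      omega
  obtain ⟨f, hf, hfm⟩ := pick L hL fun z hz => (hL' z hz).1
  obtain ⟨g, hg, hgm⟩ := pick M hM fun z hz => (hM' z hz).1
  simp only [Finset.mem_sdiff] at hf hg
  -- Leaves before `b₀` come from the edges below `(x, y₀)`, the others from those above. Having `k`
  -- fresh choices on each side makes every position of `b₀` possible.
  refine ⟨x, fun b => if b = b₀ then y₀ else if pos b < pos b₀ then f (pos b) else g (pos b), hxU,
    by simp, ?_, ?_, ?_⟩
  · intro b
    dsimp only
    split_ifs
    · exact ⟨hy₀Y, hxy⟩
    · exact ⟨hLY (hf _).1, (hL' _ (hf _).1).1⟩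
    · exact ⟨hMY (hg _).1, (hM' _ (hg _).1).1⟩
  · intro b hb
    dsimp only
    rw [if_neg hb]
    split_ifs
    · exact (hf _).2
    · exact (hg _).2
  · intro b b' hbb
    have h1 := fun j => (hL' _ (hf j).1).2
    have h2 := fun j => (hM' _ (hg j).1).2
    dsimp only
    by_cases hb : b = b₀
    · subst hb
      have hb' : b' ≠ b := by rintro rfl; exact lt_irrefl _ hbb
      rw [if_pos rfl, if_neg hb', if_neg hbb.not_gt]
      exact h2 _
    · rw [if_neg hb]
      by_cases hb' : b' = b₀
      · subst hb'
        rw [if_pos rfl, if_pos hbb]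
        exact h1 _
      · rw [if_neg hb']
        split_ifs with h3 h4 h4
        · exact hfm _ _ hbb
        · exact (h1 _).trans (h2 _)
        · exact absurd (hbb.trans h4) h3
        · exact hgm _ _ hbb

/-- The stars of a forest centred at a set of `j` independent vertices embed, respecting the order
inside each star, if the `j`-fold core is nonempty. -/
theorem exists_embedding_stars {V W : Type*} [Fintype V] [Fintype W] {Γ : SimpleGraph W}
    (hΓ : Γ.IsAcyclic) {k : ℕ} {pos : W → Fin k} (hpos : Injective pos)
    {P : Fin k → Finset (V × V)} {r : V × V → ℕ} {h : ℕ} (hr : ∀ i, Set.InjOn r (P i))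
    (hloop : ∀ i, ∀ e ∈ P i, e.1 ≠ e.2) (hh : Fintype.card W + k < h) (j : ℕ) :
    ∀ (S : Finset W) (Y : Finset V), #S = j → (∀ a ∈ S, ∀ b ∈ S, ¬ Γ.Adj a b) →
      ((core P r h)^[j] Y).Nonempty →
      ∃ φ : W → V, Set.InjOn φ {v | v ∈ S ∨ ∃ a ∈ S, Γ.Adj a v} ∧
        (∀ a ∈ S, ∀ b, Γ.Adj a b → φ b ∈ Y ∧ (φ a, φ b) ∈ P (pos a)) ∧
        ∀ a ∈ S, ∀ b b', Γ.Adj a b → Γ.Adj a b' → pos b < pos b' →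
          r (φ a, φ b) < r (φ a, φ b') := by
  classical
  induction j with
  | zero =>
    intro S Y hS _ hY
    obtain rfl := Finset.card_eq_zero.1 hS
    exact ⟨fun _ => hY.choose, by simp, by simp, by simp⟩
  | succ j ih =>
    intro S Y hS hind hY
    obtain ⟨a, ha, hcommon⟩ := exists_forall_common_neighbor_eq hΓ (S := S)
      (Finset.coe_nonempty.2 (Finset.card_pos.1 (by omega)))
    rw [iterate_succ_apply] at hY
    have ha : a ∈ S := ha
    obtain ⟨φ, hinj, hstar, hord⟩ := ih (S.erase a) (core P r h Y)
      (by rw [Finset.card_erase_of_mem ha]; omega)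
      (fun c hc b hb => hind c (Finset.mem_of_mem_erase hc) b (Finset.mem_of_mem_erase hb)) hY
    set D : Set W := {v | v ∈ S.erase a ∨ ∃ c ∈ S.erase a, Γ.Adj c v} with hD
    -- The leaf `b₀` is the neighbour that `a` shares with the earlier stars, and its image already
    -- lies in the core. If there is none, `b₀ = a` is a dummy: `a` is not its own neighbour, so
    -- that value is never used as a leaf.
    obtain ⟨y₀, b₀, hy₀, hb₀, hcon⟩ : ∃ (y₀ : V) (b₀ : W), y₀ ∈ core P r h Y ∧
        (∀ b ∈ D, Γ.Adj a b → b = b₀ ∧ φ b = y₀) ∧ (Γ.Adj a b₀ → b₀ ∈ D) := by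
      by_cases hex : ∃ b ∈ D, Γ.Adj a b
      · obtain ⟨b₀, hb₀, hab₀⟩ := hex
        have hnb : ∀ b ∈ D, Γ.Adj a b → ∃ c ∈ S.erase a, Γ.Adj c b := by
          rintro b (hb | hb) hab
          · exact absurd hab (hind a ha b (Finset.mem_of_mem_erase hb))
          · exact hb
        obtain ⟨c, hc, hcb⟩ := hnb b₀ hb₀ hab₀
        refine ⟨φ b₀, b₀, (hstar c hc b₀ hcb).1, fun b hb hab => ?_, fun _ => hb₀⟩
        obtain ⟨c', hc', hcb'⟩ := hnb b hb hab
        have : b = b₀ := hcommon b b₀ hab hab₀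
          ⟨c', Finset.mem_of_mem_erase hc', Finset.ne_of_mem_erase hc', hcb'⟩
          ⟨c, Finset.mem_of_mem_erase hc, Finset.ne_of_mem_erase hc, hcb⟩
        exact ⟨this, by rw [this]⟩
      · push Not at hex
        obtain ⟨y₀, hy₀⟩ := hY
        exact ⟨y₀, a, iterate_core_subset P r h j _ hy₀, fun b hb hab => absurd hab (hex b hb),
          fun hab => absurd hab (Γ.loopless.irrefl a)⟩
    obtain ⟨x, ψ, hxU, hψ₀, hψP, hψU, hψr⟩ := exists_star hr (pos := pos) (U := Finset.univ.image φ)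
      (lt_of_le_of_lt (Nat.add_le_add_right Finset.card_image_le k) hh) hy₀ (pos a) b₀
    have hφU : ∀ v, φ v ∈ Finset.univ.image φ := fun v =>
      Finset.mem_image_of_mem φ (Finset.mem_univ v)
    have haD : a ∉ D := by
      rintro (h1 | ⟨c, hc, hca⟩)
      · exact absurd h1 (Finset.notMem_erase a S)
      · exact hind c (Finset.mem_of_mem_erase hc) a ha hca
    let θ : W → V := fun v => if v = a then x else if Γ.Adj a v then ψ v else φ v
    have hθa : θ a = x := if_pos rfl
    have hθN : ∀ b, Γ.Adj a b → θ b = ψ b := by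
      intro b hab
      simp only [θ]
      rw [if_neg hab.ne', if_pos hab]
    have hθD : ∀ v ∈ D, θ v = φ v := by
      intro v hv
      simp only [θ]
      rw [if_neg (by rintro rfl; exact haD hv)]
      split_ifs with hav
      · obtain ⟨rfl, h2⟩ := hb₀ v hv hav
        rw [hψ₀, h2]
      · rfl
    have hψinj : Injective ψ := by
      intro b b' he
      rcases lt_trichotomy (pos b) (pos b') with hlt | heq | hlt
      · exact absurd (hψr _ _ hlt) (by rw [he]; exact lt_irrefl _)
      · exact hpos heq
      · exact absurd (hψr _ _ hlt) (by rw [he]; exact lt_irrefl _)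
    have hxψ : ∀ b, x ≠ ψ b := fun b => hloop _ _ (hψP b).2
    have hsplit : ∀ c ∈ S, c = a ∨ c ∈ S.erase a := fun c hc => by
      by_cases hca : c = a
      · exact Or.inl hca
      · exact Or.inr (Finset.mem_erase.2 ⟨hca, hc⟩)
    have hcases : ∀ v, (v ∈ S ∨ ∃ c ∈ S, Γ.Adj c v) → v = a ∨ v ∈ D ∨ (Γ.Adj a v ∧ v ∉ D) := by
      rintro v (hv | ⟨c, hc, hcv⟩)
      · rcases hsplit v hv with h1 | h1
        · exact Or.inl h1
        · exact Or.inr (Or.inl (Or.inl h1))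
      · rcases hsplit c hc with rfl | h1
        · by_cases hvD : v ∈ D
          · exact Or.inr (Or.inl hvD)
          · exact Or.inr (Or.inr ⟨hcv, hvD⟩)
        · exact Or.inr (Or.inl (Or.inr ⟨c, h1, hcv⟩))
    have hxφ : ∀ v, x ≠ φ v := fun v he => hxU (he ▸ hφU v)
    -- Only the image of `b₀` may be an old vertex, and `b₀` lies in `D` if it is adjacent to `a`.
    have hnew : ∀ v, Γ.Adj a v → v ∉ D → ∀ w, ψ v ≠ φ w := by
      intro v hav hvD w he
      exact hψU v (by rintro rfl; exact hvD (hcon hav)) (he ▸ hφU w)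
    refine ⟨θ, ?_, ?_, ?_⟩
    · intro v hv w hw he
      rcases hcases v hv with rfl | hv | ⟨hv, hvD⟩ <;>
        rcases hcases w hw with rfl | hw | ⟨hw, hwD⟩
      · rfl
      · rw [hθa, hθD w hw] at he; exact absurd he (hxφ w)
      · rw [hθa, hθN w hw] at he; exact absurd he (hxψ w)
      · rw [hθa, hθD v hv] at he; exact absurd he.symm (hxφ v)
      · rw [hθD v hv, hθD w hw] at he; exact hinj hv hw he
      · rw [hθD v hv, hθN w hw] at he; exact absurd he.symm (hnew w hw hwD v)
      · rw [hθa, hθN v hv] at he; exact absurd he.symm (hxψ v)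
      · rw [hθN v hv, hθD w hw] at he; exact absurd he (hnew v hv hvD w)
      · rw [hθN v hv, hθN w hw] at he; exact hψinj he
    · intro c hc b hcb
      rcases hsplit c hc with rfl | hc'
      · rw [hθa, hθN b hcb]
        exact hψP b
      · rw [hθD c (Or.inl hc'), hθD b (Or.inr ⟨c, hc', hcb⟩)]
        exact ⟨core_subset P r h Y (hstar c hc' b hcb).1, (hstar c hc' b hcb).2⟩
    · intro c hc b b' hcb hcb' hbb
      rcases hsplit c hc with rfl | hc'
      · rw [hθa, hθN b hcb, hθN b' hcb']
        exact hψr b b' hbb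
      · rw [hθD c (Or.inl hc'), hθD b (Or.inr ⟨c, hc', hcb⟩), hθD b' (Or.inr ⟨c, hc', hcb'⟩)]
        exact hord c hc' b b' hcb hcb' hbb

/-- The bipartite edge-ordered set `E` with ranks `r` contains a copy of `Γ` whose edges, oriented
away from the vertices satisfying `side`, are ordered lexicographically by `pos`. -/
def HasLexCopy {V W : Type*} {k : ℕ} (Γ : SimpleGraph W) (side : W → Prop) (pos : W → Fin k)
    (E : Finset (V × V)) (r : V × V → ℕ) : Prop :=
  ∃ φ : W → V, Injective φ ∧ (∀ a b, side a → Γ.Adj a b → (φ a, φ b) ∈ E) ∧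
    ∀ a b a' b', side a → side a' → Γ.Adj a b → Γ.Adj a' b' →
      (pos a < pos a' ∨ a = a' ∧ pos b < pos b') → r (φ a, φ b) < r (φ a', φ b')

theorem HasLexCopy.mono {V W : Type*} {k : ℕ} {Γ : SimpleGraph W} {side : W → Prop}
    {pos : W → Fin k} {E E' : Finset (V × V)} {r : V × V → ℕ} (hE : E ⊆ E')
    (h : HasLexCopy Γ side pos E r) : HasLexCopy Γ side pos E' r := by
  obtain ⟨φ, h1, h2, h3⟩ := h
  exact ⟨φ, h1, fun a b ha hab => hE (h2 a b ha hab), h3⟩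

/-- A nonempty iterated core yields a copy. -/
theorem hasLexCopy_of_core_nonempty {V W : Type*} [Fintype V] [Fintype W] {Γ : SimpleGraph W}
    (hΓ : Γ.IsAcyclic) {side : W → Prop} (hside : ∀ a b, side a → side b → ¬ Γ.Adj a b) {k : ℕ}
    {pos : W → Fin k} (hpos : Injective pos) (hcard : Fintype.card W ≤ Fintype.card V)
    {E : Finset (V × V)} {P : Fin k → Finset (V × V)} {r : V × V → ℕ} {h : ℕ}
    (hr : Set.InjOn r E) (hloop : ∀ e ∈ E, e.1 ≠ e.2) (hPE : ∀ i, P i ⊆ E)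
    (hP : ∀ i j, i < j → ∀ e ∈ P i, ∀ e' ∈ P j, r e < r e') (hh : Fintype.card W + k < h)
    {Y : Finset V} (hY : ((core P r h)^[k] Y).Nonempty) : HasLexCopy Γ side pos E r := by
  classical
  let S : Finset W := {w | side w}
  have hS : ∀ a, a ∈ S ↔ side a := by simp [S]
  have hSk : #S ≤ k := (Finset.card_le_univ S).trans (by
    simpa using Fintype.card_le_of_injective pos hpos)
  -- Iterated cores decrease and there are at most `k` centres, so `k` iterations suffice whatever
  -- the size of `S`.
  have hY' : ((core P r h)^[#S] Y).Nonempty := by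
    obtain ⟨m, hm⟩ := Nat.exists_eq_add_of_le' hSk
    have he : ∀ l, l = m + #S → (core P r h)^[l] Y = (core P r h)^[m] ((core P r h)^[#S] Y) := by
      rintro _ rfl
      exact iterate_add_apply _ _ _ _
    rw [he k hm] at hY
    exact hY.mono (iterate_core_subset P r h m _)
  obtain ⟨φ, hinj, hstar, hord⟩ := exists_embedding_stars hΓ hpos
    (fun i => hr.mono (hPE i)) (fun i e he => hloop e (hPE i he)) hh _ S Y rfl
    (fun a ha b hb => hside a b ((hS a).1 ha) ((hS b).1 hb)) hY'
  obtain ⟨ψ, hψ, hψφ⟩ := exists_injective_extend hcard hinj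
  have h1 : ∀ a, side a → ψ a = φ a := fun a ha => hψφ a (Or.inl ((hS a).2 ha))
  have h2 : ∀ a b, side a → Γ.Adj a b → ψ b = φ b := fun a b ha hab =>
    hψφ b (Or.inr ⟨a, (hS a).2 ha, hab⟩)
  refine ⟨ψ, hψ, fun a b ha hab => ?_, fun a b a' b' ha ha' hab hab' hlt => ?_⟩
  · rw [h1 a ha, h2 a b ha hab]
    exact hPE _ (hstar a ((hS a).2 ha) b hab).2
  · rw [h1 a ha, h2 a b ha hab, h1 a' ha', h2 a' b' ha' hab']
    -- Edges of different stars are compared through their blocks, edges of one star through its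
    -- leaves.
    rcases hlt with hlt | ⟨rfl, hlt⟩
    · exact hP _ _ hlt _ (hstar a ((hS a).2 ha) b hab).2 _ (hstar a' ((hS a').2 ha') b' hab').2
    · exact hord a ((hS a).2 ha) b b' hab hab' hlt

/-! ### Weight lost in passing to cores -/

open Classical in
-- Only the `h` smallest and the `h` largest edges of `P` from `x` into `Y` can fail to be inner.
theorem card_filter_not_isInner_le {V : Type*} {P : Finset (V × V)} {r : V × V → ℕ}
    (hr : Set.InjOn r P) (h : ℕ) (Y : Finset V) (x : V) :
    #{y ∈ Y | (x, y) ∈ P ∧ ¬ IsInner P r h Y x y} ≤ 2 * h := by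
  set T : Finset V := {y ∈ Y | (x, y) ∈ P} with hT
  have hg : Set.InjOn (fun y => r (x, y)) T := by
    intro y hy y' hy' he
    have := hr (Finset.mem_filter.1 (Finset.mem_coe.1 hy)).2
      (Finset.mem_filter.1 (Finset.mem_coe.1 hy')).2 he
    simpa using this
  have hsub : ({y ∈ Y | (x, y) ∈ P ∧ ¬ IsInner P r h Y x y} : Finset V) ⊆
      {y ∈ T | #{z ∈ T | r (x, z) < r (x, y)} < h} ∪
        {y ∈ T | #{z ∈ T | r (x, y) < r (x, z)} < h} := by
    intro y hy
    obtain ⟨hyY, hyP, hin⟩ := Finset.mem_filter.1 hy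
    have hyT : y ∈ T := Finset.mem_filter.2 ⟨hyY, hyP⟩
    by_contra hcon
    have h1 := not_lt.1 fun hlt =>
      hcon (Finset.mem_union_left _ (Finset.mem_filter.2 ⟨hyT, hlt⟩))
    have h2 := not_lt.1 fun hlt =>
      hcon (Finset.mem_union_right _ (Finset.mem_filter.2 ⟨hyT, hlt⟩))
    refine hin ⟨hyP, ⟨_, ?_, h1, ?_⟩, ⟨_, ?_, h2, ?_⟩⟩
    · exact (Finset.filter_subset _ _).trans (Finset.filter_subset _ _)
    · intro z hz
      obtain ⟨h1, h2⟩ := Finset.mem_filter.1 hz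
      exact ⟨(Finset.mem_filter.1 h1).2, h2⟩
    · exact (Finset.filter_subset _ _).trans (Finset.filter_subset _ _)
    · intro z hz
      obtain ⟨h1, h2⟩ := Finset.mem_filter.1 hz
      exact ⟨(Finset.mem_filter.1 h1).2, h2⟩
  have h1 := card_filter_card_key_lt_lt T hg h
  have h2 := card_filter_card_lt_key_lt T hg h
  have h3 := (Finset.card_le_card hsub).trans (Finset.card_union_le _ _)
  omega

open Classical in
/-- Passing to the core loses little weight. -/
theorem sum_le_sum_core {V : Type*} [Fintype V] {k : ℕ} {P : Fin k → Finset (V × V)}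
    {r : V × V → ℕ} (hr : ∀ i, Set.InjOn r (P i)) {X : Finset V}
    (h c : ℕ) {Y : Finset V} {D : V → ℕ}
    (hD : ∀ y ∈ Y, ∀ i, D y ≤ c * #{x ∈ X | (x, y) ∈ P i}) :
    ∑ y ∈ Y, D y ≤ ∑ y ∈ core P r h Y, D y + c * ((2 * k + 1) * h * (#X + #Y)) := by
  -- A vertex outside the core has fewer than `h` inner edges in some `P i`. Its other edges there
  -- are non-inner and are charged to their ends in `X`, each of which receives at most `2 * h`
  -- charges per block.
  have hpt : ∀ y ∈ Y \ core P r h Y,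
      D y ≤ c * (h + ∑ i, #{x ∈ X | (x, y) ∈ P i ∧ ¬ IsInner (P i) r h Y x y}) := by
    intro y hy
    obtain ⟨hyY, hyc⟩ := Finset.mem_sdiff.1 hy
    have : ∃ i, #{x | IsInner (P i) r h Y x y} < h := by
      by_contra hcon
      push Not at hcon
      exact hyc (Finset.mem_filter.2 ⟨hyY, hcon⟩)
    obtain ⟨i, hi⟩ := this
    refine (hD y hyY i).trans (Nat.mul_le_mul_left c ?_)
    have h1 : ({x ∈ X | (x, y) ∈ P i} : Finset V) ⊆ ({x | IsInner (P i) r h Y x y} : Finset V) ∪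
        {x ∈ X | (x, y) ∈ P i ∧ ¬ IsInner (P i) r h Y x y} := by
      intro x hx
      simp only [mem_filter, mem_union, mem_univ, true_and] at hx ⊢
      by_cases hin : IsInner (P i) r h Y x y
      · exact Or.inl hin
      · exact Or.inr ⟨hx.1, hx.2, hin⟩
    have h2 := (Finset.card_le_card h1).trans (Finset.card_union_le _ _)
    have h3 := Finset.single_le_sum
      (f := fun i => #{x ∈ X | (x, y) ∈ P i ∧ ¬ IsInner (P i) r h Y x y})
      (fun _ _ => Nat.zero_le _) (Finset.mem_univ i)
    omega
  have hcount : ∀ i, ∑ y ∈ Y \ core P r h Y,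
      #{x ∈ X | (x, y) ∈ P i ∧ ¬ IsInner (P i) r h Y x y} ≤ #X * (2 * h) := by
    intro i
    calc _ ≤ ∑ y ∈ Y, #{x ∈ X | (x, y) ∈ P i ∧ ¬ IsInner (P i) r h Y x y} :=
          Finset.sum_le_sum_of_subset Finset.sdiff_subset
      _ = ∑ x ∈ X, #{y ∈ Y | (x, y) ∈ P i ∧ ¬ IsInner (P i) r h Y x y} := by
          simp only [Finset.card_filter]
          exact Finset.sum_comm
      _ ≤ ∑ x ∈ X, 2 * h :=
          Finset.sum_le_sum fun x _ => card_filter_not_isInner_le (hr i) h Y x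
      _ = #X * (2 * h) := by simp
  rw [← Finset.sum_sdiff (core_subset P r h Y), add_comm]
  refine Nat.add_le_add_left ?_ _
  calc _ ≤ ∑ y ∈ Y \ core P r h Y,
        c * (h + ∑ i, #{x ∈ X | (x, y) ∈ P i ∧ ¬ IsInner (P i) r h Y x y}) :=
        Finset.sum_le_sum hpt
    _ = c * (#(Y \ core P r h Y) * h + ∑ i, ∑ y ∈ Y \ core P r h Y,
        #{x ∈ X | (x, y) ∈ P i ∧ ¬ IsInner (P i) r h Y x y}) := by
        rw [← Finset.mul_sum, Finset.sum_add_distrib, Finset.sum_comm]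
        simp
    _ ≤ c * (#Y * h + ∑ _i : Fin k, #X * (2 * h)) := by
        gcongr with i _
        · exact Finset.sdiff_subset
        · exact hcount i
    _ ≤ c * ((2 * k + 1) * h * (#X + #Y)) := by
        apply Nat.mul_le_mul_left
        simp only [sum_const, card_univ, Fintype.card_fin, smul_eq_mul]
        nlinarith [Nat.zero_le (k * h * #Y), Nat.zero_le (h * #X)]

open Classical in
-- Iterated cores stay inside `Y`, so each of the `j` passages costs no more than the error computed
-- for `Y`.
theorem sum_le_sum_iterate_core {V : Type*} [Fintype V] {k : ℕ} {P : Fin k → Finset (V × V)}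
    {r : V × V → ℕ} (hr : ∀ i, Set.InjOn r (P i)) {X : Finset V}
    (h c : ℕ) {Y : Finset V} {D : V → ℕ}
    (hD : ∀ y ∈ Y, ∀ i, D y ≤ c * #{x ∈ X | (x, y) ∈ P i}) (j : ℕ) :
    ∑ y ∈ Y, D y ≤
      ∑ y ∈ (core P r h)^[j] Y, D y + j * (c * ((2 * k + 1) * h * (#X + #Y))) := by
  induction j with
  | zero => simp
  | succ j ih =>
    have hsub := iterate_core_subset P r h j Y
    have h1 := sum_le_sum_core hr h c (Y := (core P r h)^[j] Y) fun y hy => hD y (hsub hy)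
    rw [iterate_succ_apply']
    have h2 : c * ((2 * k + 1) * h * (#X + #((core P r h)^[j] Y))) ≤
        c * ((2 * k + 1) * h * (#X + #Y)) := by
      gcongr
    rw [Nat.succ_mul]
    omega

/-- If no copy exists, vertices with edges spread over `k` successive blocks have small total
weight. -/
theorem sum_spread_le {V W : Type*} [Fintype V] [Fintype W] [DecidableEq V] {Γ : SimpleGraph W}
    (hΓ : Γ.IsAcyclic) {side : W → Prop} (hside : ∀ a b, side a → side b → ¬ Γ.Adj a b) {k : ℕ}
    {pos : W → Fin k} (hpos : Injective pos) (hcard : Fintype.card W ≤ Fintype.card V)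
    {E : Finset (V × V)} {P : Fin k → Finset (V × V)} {r : V × V → ℕ}
    (hr : Set.InjOn r E) (hloop : ∀ e ∈ E, e.1 ≠ e.2) (hPE : ∀ i, P i ⊆ E)
    (hP : ∀ i j, i < j → ∀ e ∈ P i, ∀ e' ∈ P j, r e < r e') {h : ℕ} (hh : Fintype.card W + k < h)
    {X Y : Finset V} {c : ℕ} {D : V → ℕ}
    (hD : ∀ y ∈ Y, ∀ i, D y ≤ c * #{x ∈ X | (x, y) ∈ P i})
    (hE : ¬ HasLexCopy Γ side pos E r) :
    ∑ y ∈ Y, D y ≤ k * (c * ((2 * k + 1) * h * (#X + #Y))) := by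
  classical
  have h1 := sum_le_sum_iterate_core (fun i => hr.mono (hPE i)) h c
    (Y := Y) (D := D) (by convert hD) k
  have h2 : (core P r h)^[k] Y = ∅ := by
    rw [← Finset.not_nonempty_iff_eq_empty]
    exact fun hne => hE (hasLexCopy_of_core_nonempty hΓ hside hpos hcard hr hloop hPE hP hh hne)
  rw [h2] at h1
  simpa using h1

/-! ### Concentration in a single block -/

/-- A vertex whose edges are not spread over `k` of `t` blocks has a block containing a constant
proportion of them. -/
theorem exists_le_mul_of_not_spread {t k : ℕ} (ht : 0 < t) (d : Fin t → ℕ)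
    (hk : ¬ ∃ T : Fin k → Fin t, StrictMono T ∧ ∀ i, ∑ j, d j ≤ 2 * t * d (T i)) :
    ∃ i, ∑ j, d j ≤ 2 * k * d i := by
  classical
  have : Nonempty (Fin t) := ⟨⟨0, ht⟩⟩
  set S := ∑ j, d j with hS
  -- There are fewer than `k` heavy blocks, and the light ones together hold at most half of `S`. So
  -- the largest block has at least `S / (2 * k)`.
  let Hv : Finset (Fin t) := {i | S ≤ 2 * t * d i}
  have hHv : #Hv < k := by
    by_contra hcon
    push Not at hcon
    refine hk ⟨Hv.orderEmbOfCardLe hcon, (Hv.orderEmbOfCardLe hcon).strictMono, fun i => ?_⟩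
    exact (Finset.mem_filter.1 (Finset.orderEmbOfCardLe_mem Hv hcon i)).2
  obtain ⟨m, -, hm⟩ := Finset.exists_max_image (Finset.univ : Finset (Fin t)) d
    Finset.univ_nonempty
  refine ⟨m, ?_⟩
  have h1 : ∑ j ∈ Hv, d j ≤ k * d m := by
    calc _ ≤ #Hv • d m := Finset.sum_le_card_nsmul _ _ _ fun j _ => hm j (Finset.mem_univ j)
      _ ≤ k * d m := Nat.mul_le_mul_right _ hHv.le
  have h2 : 2 * t * ∑ j ∈ Finset.univ \ Hv, d j ≤ t * S := by
    rw [Finset.mul_sum]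
    calc _ ≤ #(Finset.univ \ Hv) • S := by
          refine Finset.sum_le_card_nsmul _ _ _ fun j hj => ?_
          have := (Finset.mem_sdiff.1 hj).2
          simp only [Hv, mem_filter, mem_univ, true_and, not_le] at this
          exact this.le
      _ ≤ t * S := by
          refine Nat.mul_le_mul_right _ ((Finset.card_le_univ _).trans ?_)
          simp
  have h3 : ∑ j ∈ Finset.univ \ Hv, d j + ∑ j ∈ Hv, d j = S :=
    Finset.sum_sdiff (Finset.subset_univ _)
  have h4 : 2 * ∑ j ∈ Finset.univ \ Hv, d j ≤ S := by
    refine Nat.le_of_mul_le_mul_left ?_ ht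
    calc _ = 2 * t * ∑ j ∈ Finset.univ \ Hv, d j := by ring
      _ ≤ _ := h2
  nlinarith

theorem sum_biUnion_le {ι V : Type*} [DecidableEq V] (T : Finset ι) (Z : ι → Finset V)
    (D : V → ℕ) : ∑ y ∈ T.biUnion Z, D y ≤ ∑ i ∈ T, ∑ y ∈ Z i, D y := by
  classical
  induction T using Finset.induction_on with
  | empty => simp
  | insert i T hi ih =>
    rw [Finset.biUnion_insert, Finset.sum_insert hi]
    have := Finset.sum_union_inter (s₁ := Z i) (s₂ := T.biUnion Z) (f := D)
    omega

/-- If no copy exists, then up to few edges a constant proportion of the edges lie in one block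
chosen by their second endpoint. -/
theorem exists_concentration {V W : Type*} [Fintype V] [Fintype W] {Γ : SimpleGraph W}
    (hΓ : Γ.IsAcyclic) {side : W → Prop} (hside : ∀ a b, side a → side b → ¬ Γ.Adj a b) {k : ℕ}
    {pos : W → Fin k} (hpos : Injective pos) (hcard : Fintype.card W ≤ Fintype.card V)
    {E : Finset (V × V)} {r : V × V → ℕ}
    (hr : Set.InjOn r E) (hloop : ∀ e ∈ E, e.1 ≠ e.2) {t : ℕ} (ht : 0 < t) {q : V × V → Fin t}
    (hq : ∀ e ∈ E, ∀ e' ∈ E, q e < q e' → r e < r e') {h : ℕ} (hh : Fintype.card W + k < h)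
    {X Y : Finset V} (hX : ∀ e ∈ E, e.1 ∈ X) (hY : ∀ e ∈ E, e.2 ∈ Y)
    (hE : ¬ HasLexCopy Γ side pos E r) :
    ∃ f : V → Fin t, #E ≤ 2 * k * (2 * k + 1) * h * t ^ (k + 1) * (#X + #Y) +
      2 * k * #{e ∈ E | q e = f e.2} := by
  classical
  let d : V → Fin t → ℕ := fun y i => #{x ∈ X | (x, y) ∈ E ∧ q (x, y) = i}
  let D : V → ℕ := fun y => ∑ i, d y i
  -- Spread vertices are grouped by the increasing choice `τ` of `k` heavy blocks. At most `t ^ k`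
  -- choices, with weight factor `2 * t` each, produce the power `t ^ (k + 1)`.
  let T : Finset (Fin k → Fin t) := {τ | StrictMono τ}
  let Z : (Fin k → Fin t) → Finset V := fun τ => {y ∈ Y | ∀ i, D y ≤ 2 * t * d y (τ i)}
  let Sp : Finset V := T.biUnion Z
  have hfib : ∀ F : Finset (V × V), F ⊆ E → #F = ∑ y ∈ Y, #{x ∈ X | (x, y) ∈ F} := by
    intro F hF
    rw [Finset.card_eq_sum_card_fiberwise (f := Prod.snd) (t := Y) (fun e he => hY e (hF he))]
    refine Finset.sum_congr rfl fun y _ => ?_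
    refine Finset.card_bij (fun e _ => e.1) ?_ ?_ ?_
    · rintro ⟨x, y'⟩ he
      obtain ⟨h1, rfl⟩ := Finset.mem_filter.1 he
      exact Finset.mem_filter.2 ⟨hX _ (hF h1), h1⟩
    · rintro ⟨x, y1⟩ h1 ⟨x', y2⟩ h2 hxx
      obtain ⟨-, h1⟩ := Finset.mem_filter.1 h1
      obtain ⟨-, h2⟩ := Finset.mem_filter.1 h2
      exact Prod.ext hxx (h1.trans h2.symm)
    · intro x hx
      exact ⟨(x, y), Finset.mem_filter.2 ⟨(Finset.mem_filter.1 hx).2, rfl⟩, rfl⟩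
  have hDE : ∀ y, D y = #{x ∈ X | (x, y) ∈ E} := by
    intro y
    rw [Finset.card_eq_sum_card_fiberwise (f := fun x => q (x, y)) (t := Finset.univ)
      (fun _ _ => Finset.mem_coe.2 (Finset.mem_univ _))]
    refine Finset.sum_congr rfl fun i _ => ?_
    simp only [d, Finset.filter_filter]
  have hspread : ∑ y ∈ Sp, D y ≤
      2 * k * (2 * k + 1) * h * t ^ (k + 1) * (#X + #Y) := by
    have hone : ∀ τ ∈ T, ∑ y ∈ Z τ, D y ≤ k * (2 * t * ((2 * k + 1) * h * (#X + #Y))) := by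
      intro τ hτ
      have hτ' : StrictMono τ := (Finset.mem_filter.1 hτ).2
      refine (sum_spread_le hΓ hside hpos hcard (P := fun i => {e ∈ E | q e = τ i}) hr hloop
        (fun i => Finset.filter_subset _ _) ?_ hh (X := X) (Y := Z τ) (c := 2 * t) (D := D) ?_ hE).trans ?_
      · intro i j hij e he e' he'
        obtain ⟨h1, h2⟩ := Finset.mem_filter.1 he
        obtain ⟨h3, h4⟩ := Finset.mem_filter.1 he'
        exact hq e h1 e' h3 (by rw [h2, h4]; exact hτ' hij)
      · intro y hy i
        have := (Finset.mem_filter.1 hy).2 i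
        simpa only [d, mem_filter] using this
      · have : #(Z τ) ≤ #Y := Finset.card_le_card (Finset.filter_subset _ _)
        gcongr
    calc ∑ y ∈ Sp, D y ≤ ∑ τ ∈ T, ∑ y ∈ Z τ, D y := sum_biUnion_le T Z D
      _ ≤ #T • (k * (2 * t * ((2 * k + 1) * h * (#X + #Y)))) :=
          Finset.sum_le_card_nsmul _ _ _ hone
      _ ≤ t ^ k * (k * (2 * t * ((2 * k + 1) * h * (#X + #Y)))) := by
          refine Nat.mul_le_mul_right _ ((Finset.card_le_univ _).trans ?_)
          simp
      _ = _ := by ring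
  have hmax : ∀ y, ∃ i, y ∈ Y \ Sp → D y ≤ 2 * k * d y i := by
    intro y
    by_cases hy : y ∈ Y \ Sp
    · obtain ⟨hyY, hyS⟩ := Finset.mem_sdiff.1 hy
      obtain ⟨i, hi⟩ := exists_le_mul_of_not_spread ht (d y) (k := k) (by
        rintro ⟨τ, hτ, hτD⟩
        exact hyS (Finset.mem_biUnion.2 ⟨τ, Finset.mem_filter.2 ⟨Finset.mem_univ _, hτ⟩,
          Finset.mem_filter.2 ⟨hyY, hτD⟩⟩))
      exact ⟨i, fun _ => hi⟩
    · exact ⟨⟨0, ht⟩, fun hy' => absurd hy' hy⟩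
  choose f hf using hmax
  refine ⟨f, ?_⟩
  have hSpY : Sp ⊆ Y := Finset.biUnion_subset.2 fun τ _ => Finset.filter_subset _ _
  have hE1 : #E = ∑ y ∈ Y, D y := by
    rw [hfib E subset_rfl]
    exact Finset.sum_congr rfl fun y _ => (hDE y).symm
  have hE2 : #{e ∈ E | q e = f e.2} = ∑ y ∈ Y, d y (f y) := by
    rw [hfib _ (Finset.filter_subset _ _)]
    simp only [d, mem_filter]
  rw [hE1, hE2, ← Finset.sum_sdiff hSpY, add_comm]
  refine Nat.add_le_add hspread ?_
  rw [Finset.mul_sum]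
  exact (Finset.sum_le_sum fun y hy => hf y hy).trans
    (Finset.sum_le_sum_of_subset Finset.sdiff_subset)

/-! ### Recursion over blocks -/

/-- A finite set of at most `t * M` keyed elements splits into `t` blocks of at most `M` elements,
monotonically in the key. -/
theorem exists_blocks {α : Type*} (E : Finset α) {r : α → ℕ} (hr : Set.InjOn r E) {t M : ℕ}
    (hM : 0 < M) (ht : 0 < t) (hE : #E ≤ t * M) :
    ∃ q : α → Fin t, (∀ e ∈ E, ∀ e' ∈ E, q e < q e' → r e < r e') ∧
      ∀ i, #{e ∈ E | q e = i} ≤ M := by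
  classical
  let cnt : α → ℕ := fun e => #{z ∈ E | r z < r e}
  have hlt : ∀ e ∈ E, cnt e / M < t := by
    intro e he
    rw [Nat.div_lt_iff_lt_mul hM]
    refine lt_of_lt_of_le (Finset.card_lt_card ?_) hE
    exact (Finset.ssubset_iff_of_subset (Finset.filter_subset _ _)).2 ⟨e, he, by simp⟩
  -- The reduction modulo `t` has no effect on `E`; it only gives elements outside `E` a value in
  -- `Fin t`.
  refine ⟨fun e => ⟨cnt e / M % t, Nat.mod_lt _ ht⟩, ?_, ?_⟩
  · intro e he e' he' hq
    simp only [Fin.mk_lt_mk] at hq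
    rw [Nat.mod_eq_of_lt (hlt e he), Nat.mod_eq_of_lt (hlt e' he')] at hq
    by_contra hcon
    push Not at hcon
    have : cnt e' ≤ cnt e := Finset.card_le_card fun z => by
      simp only [mem_filter]
      exact fun hz => ⟨hz.1, hz.2.trans_le hcon⟩
    exact absurd (Nat.div_le_div_right (c := M) this) (by omega)
  · intro i
    have : #{e ∈ E | (⟨cnt e / M % t, Nat.mod_lt _ ht⟩ : Fin t) = i} ≤
        #(Finset.Ico (i * M) ((i + 1) * M)) := by
      refine Finset.card_le_card_of_injOn cnt ?_
        ((injOn_card_filter_key_lt E hr).mono (Finset.coe_subset.2 (Finset.filter_subset _ _)))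
      intro e he
      obtain ⟨he, hi⟩ := Finset.mem_filter.1 (Finset.mem_coe.1 he)
      have hi := congrArg Fin.val hi
      simp only at hi
      rw [Nat.mod_eq_of_lt (hlt e he)] at hi
      rw [Finset.mem_coe, Finset.mem_Ico, ← hi]
      exact ⟨Nat.div_mul_le_self _ _, by
        rw [← Nat.div_lt_iff_lt_mul hM]; exact Nat.lt_succ_self _⟩
    refine this.trans ?_
    rw [Nat.card_Ico, ← Nat.sub_mul]
    simp

/-- The edge bound in terms of the number `t` of blocks and the recursion depth `j`. -/
theorem card_le_of_not_hasLexCopy {V W : Type*} [Fintype V] [DecidableEq V] [Fintype W]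
    {Γ : SimpleGraph W} (hΓ : Γ.IsAcyclic) {side : W → Prop}
    (hside : ∀ a b, side a → side b → ¬ Γ.Adj a b) {k : ℕ} {pos : W → Fin k}
    (hpos : Injective pos) (hcard : Fintype.card W ≤ Fintype.card V) {r : V × V → ℕ} {h t : ℕ}
    (hh : Fintype.card W + k < h) (ht : 0 < t) (j : ℕ) :
    ∀ (E : Finset (V × V)) (X Y : Finset V), Set.InjOn r E → (∀ e ∈ E, e.1 ≠ e.2) →
      (∀ e ∈ E, e.1 ∈ X) → (∀ e ∈ E, e.2 ∈ Y) → ¬ HasLexCopy Γ side pos E r →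
      ¬ HasLexCopy Γ side pos (E.image Prod.swap) (r ∘ Prod.swap) → #E ≤ t ^ j →
      #E ≤ (4 * k ^ 2 + 1) ^ j *
        ((2 * k + 1) * (2 * k * (2 * k + 1) * h * t ^ (k + 1)) + 1) * (#X + #Y) := by
  set B := 2 * k * (2 * k + 1) * h * t ^ (k + 1) with hB
  induction j with
  | zero =>
    intro E X Y _ _ hX _ _ _ hE
    rcases E.eq_empty_or_nonempty with rfl | ⟨e, he⟩
    · simp
    · have : 1 ≤ #X := Finset.card_pos.2 ⟨e.1, hX e he⟩
      have : 1 ≤ ((4 * k ^ 2 + 1) ^ 0 * ((2 * k + 1) * B + 1)) * (#X + #Y) :=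
        Nat.mul_pos (by positivity) (by omega)
      rw [pow_zero] at hE
      exact hE.trans this
  | succ j ih =>
    intro E X Y hr hloop hX hY hE hE' hEt
    obtain ⟨q, hq, hqc⟩ := exists_blocks E hr (pow_pos ht j) ht (by rwa [← pow_succ'])
    obtain ⟨f, hf⟩ := exists_concentration hΓ hside hpos hcard hr hloop ht hq hh hX hY hE
    set E₁ : Finset (V × V) := {e ∈ E | q e = f e.2} with hE₁
    have hE₁E : E₁ ⊆ E := Finset.filter_subset _ _
    have hswap : ∀ e, e ∈ E₁.image Prod.swap ↔ e.swap ∈ E₁ := by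
      intro e
      rw [Finset.mem_image]
      constructor
      · rintro ⟨e', he', rfl⟩
        simpa using he'
      · exact fun he => ⟨e.swap, he, by simp⟩
    -- With the sides swapped, concentration at the first endpoints applies to the edges already
    -- concentrated at their second endpoints.
    obtain ⟨g, hg⟩ := exists_concentration hΓ hside hpos hcard (E := E₁.image Prod.swap)
      (r := r ∘ Prod.swap) (q := q ∘ Prod.swap) (X := Y) (Y := X) (by
        intro e he e' he' hee
        exact Prod.swap_injective (hr (hE₁E ((hswap e).1 he)) (hE₁E ((hswap e').1 he')) hee))
      (fun e he => (hloop _ (hE₁E ((hswap e).1 he))).symm) ht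
      (fun e he e' he' => hq _ (hE₁E ((hswap e).1 he)) _ (hE₁E ((hswap e').1 he'))) hh
      (fun e he => hY _ (hE₁E ((hswap e).1 he))) (fun e he => hX _ (hE₁E ((hswap e).1 he)))
      (fun hcopy => hE' (hcopy.mono (Finset.image_mono _ hE₁E)))
    rw [Finset.card_image_of_injective _ Prod.swap_injective] at hg
    set E₂ : Finset (V × V) := {e ∈ E₁ | q e = g e.1} with hE₂
    have hE₂E : E₂ ⊆ E := (Finset.filter_subset _ _).trans hE₁E
    have hcard₂ : #{e ∈ E₁.image Prod.swap | (q ∘ Prod.swap) e = g e.2} = #E₂ := by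
      rw [Finset.filter_image, Finset.card_image_of_injective _ Prod.swap_injective]
      simp [hE₂]
    rw [hcard₂] at hg
    set F := (4 * k ^ 2 + 1) ^ j * ((2 * k + 1) * B + 1) with hF
    -- An edge of `E₂` in block `i` joins the class `g = i` of `X` to the class `f = i` of `Y`.
    -- These classes partition `X` and `Y`, so the inductive bounds sum without loss.
    have hblock : ∀ i, #{e ∈ E₂ | q e = i} ≤ F * (#{x ∈ X | g x = i} + #{y ∈ Y | f y = i}) := by
      intro i
      have hsub : ({e ∈ E₂ | q e = i} : Finset (V × V)) ⊆ E :=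
        (Finset.filter_subset _ _).trans hE₂E
      have hmem : ∀ e ∈ ({e ∈ E₂ | q e = i} : Finset (V × V)), g e.1 = i ∧ f e.2 = i := by
        intro e he
        simp only [hE₂, hE₁, mem_filter] at he
        exact ⟨he.1.2.symm.trans he.2, he.1.1.2.symm.trans he.2⟩
      refine ih _ _ _ (hr.mono hsub) (fun e he => hloop e (hsub he))
        (fun e he => Finset.mem_filter.2 ⟨hX e (hsub he), (hmem e he).1⟩)
        (fun e he => Finset.mem_filter.2 ⟨hY e (hsub he), (hmem e he).2⟩)
        (fun hcopy => hE (hcopy.mono hsub))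
        (fun hcopy => hE' (hcopy.mono (Finset.image_mono _ hsub)))
        ((Finset.card_le_card ?_).trans (hqc i))
      exact Finset.filter_subset_filter _ hE₂E
    have hE₂F : #E₂ ≤ F * (#X + #Y) := by
      rw [Finset.card_eq_sum_card_fiberwise (f := q) (t := Finset.univ)
          (fun _ _ => Finset.mem_coe.2 (Finset.mem_univ _)),
        Finset.card_eq_sum_card_fiberwise (f := g) (s := X) (t := Finset.univ)
          (fun _ _ => Finset.mem_coe.2 (Finset.mem_univ _)),
        Finset.card_eq_sum_card_fiberwise (f := f) (s := Y) (t := Finset.univ)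
          (fun _ _ => Finset.mem_coe.2 (Finset.mem_univ _)),
        ← Finset.sum_add_distrib, Finset.mul_sum]
      exact Finset.sum_le_sum fun i _ => hblock i
    have hpow : 1 ≤ (4 * k ^ 2 + 1) ^ j := Nat.one_le_pow _ _ (by omega)
    have hFB : (2 * k + 1) * B ≤ F := by
      calc (2 * k + 1) * B ≤ 1 * ((2 * k + 1) * B + 1) := by omega
        _ ≤ F := Nat.mul_le_mul_right _ hpow
    calc #E ≤ B * (#X + #Y) + 2 * k * (B * (#Y + #X) + 2 * k * (F * (#X + #Y))) :=
          hf.trans (Nat.add_le_add_left (Nat.mul_le_mul_left _ (hg.trans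
            (Nat.add_le_add_left (Nat.mul_le_mul_left _ hE₂F) _))) _)
      _ = ((2 * k + 1) * B) * (#X + #Y) + 4 * k ^ 2 * F * (#X + #Y) := by ring
      _ ≤ F * (#X + #Y) + 4 * k ^ 2 * F * (#X + #Y) :=
          Nat.add_le_add_right (Nat.mul_le_mul_right _ hFB) _
      _ = _ := by rw [hF]; ring

/-! ### Lexicographic orderings and edge-ordered graphs -/

/-- An edge-ordered graph of order chromatic number two embeds into a lexicographically ordered
complete bipartite graph. -/
theorem exists_lex_of_orderChromaticNumber_eq_two {W : Type*} {H : EdgeOrderedGraph W}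
    (hH : H.orderChromaticNumber = 2) :
    ∃ (k : ℕ) (pos : W → Fin k) (side : W → Prop), Injective pos ∧
      (∀ a b, H.graph.Adj a b → (side a ↔ ¬ side b)) ∧
      ∀ a b a' b' (hab : H.graph.Adj a b) (hab' : H.graph.Adj a' b'), side a → side a' →
        H.order.lt ⟨s(a, b), hab⟩ ⟨s(a', b'), hab'⟩ →
        pos a < pos a' ∨ a = a' ∧ pos b < pos b' := by
  classical
  have hne : {c : ℕ∞ | ∃ (N : ℕ) (G : SimpleGraph (Fin N)),
      ¬ CanAvoid G H ∧ c = G.chromaticNumber}.Nonempty := by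
    by_contra hcon
    rw [Set.not_nonempty_iff_eq_empty] at hcon
    -- If no graph qualified, the infimum would be `⊤` and not 2. Hence it is attained, by a
    -- bipartite graph.
    rw [orderChromaticNumber, hcon, sInf_empty] at hH
    exact absurd hH (by decide)
  have hmem := csInf_mem hne
  rw [show sInf _ = (2 : ℕ∞) from hH] at hmem
  obtain ⟨N, G, hG, hc⟩ := hmem
  have hcol : G.Colorable 2 := SimpleGraph.chromaticNumber_le_iff_colorable.1 hc.symm.le
  obtain ⟨c⟩ := hcol
  have hend : ∀ e : G.edgeSet, ∃ p : Fin N × Fin N, c p.1 = 0 ∧ (e : Sym2 (Fin N)) = s(p.1, p.2) := by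
    rintro ⟨e, he⟩
    induction e with
    | _ x y =>
      have hxy : c x ≠ c y := c.valid he
      by_cases hx : c x = 0
      · exact ⟨(x, y), hx, rfl⟩
      · exact ⟨(y, x), by simp only; omega, Sym2.eq_swap⟩
  choose p hp0 hp using hend
  -- This is the lexicographic edge-ordering of `G`, with the endpoint of colour 0 first. As `G`
  -- cannot avoid `H`, it contains a copy of `H`, which supplies `pos` and `side`.
  let key : G.edgeSet → Fin N ×ₗ Fin N := fun e => toLex (p e)
  have hkey : Injective key := by
    intro e e' he
    have : p e = p e' := toLex.injective he
    exact Subtype.ext (by rw [hp e, hp e', this])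
  have hcont : (EdgeOrderedGraph.mk G (LinearOrder.lift' key hkey)).Contains H := by
    by_contra hcon
    exact hG ⟨_, hcon⟩
  obtain ⟨f, hf⟩ := hcont
  have hadj : ∀ {a b}, H.graph.Adj a b → G.Adj (f a) (f b) := fun hab => f.toHom.map_adj hab
  have hpe : ∀ a b (hab : H.graph.Adj a b), c (f a) = 0 →
      p (f.mapEdgeSet ⟨s(a, b), hab⟩) = (f a, f b) := by
    intro a b hab ha
    have h1 : s(f a, f b) = s((p (f.mapEdgeSet ⟨s(a, b), hab⟩)).1, (p (f.mapEdgeSet ⟨s(a, b), hab⟩)).2) :=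
      hp (f.mapEdgeSet ⟨s(a, b), hab⟩)
    have h0 := hp0 (f.mapEdgeSet ⟨s(a, b), hab⟩)
    rcases Sym2.eq_iff.1 h1 with ⟨h2, h3⟩ | ⟨h2, h3⟩
    · exact Prod.ext h2.symm h3.symm
    · exact absurd (ha.trans (h0.symm.trans (congrArg c h3.symm))) (c.valid (hadj hab))
  refine ⟨N, f, fun w => c (f w) = 0, f.injective, fun a b hab => ?_, ?_⟩
  · have : c (f a) ≠ c (f b) := c.valid (hadj hab)
    dsimp only
    omega
  · intro a b a' b' hab hab' ha ha' hlt
    have h1 : key (f.mapEdgeSet ⟨s(a, b), hab⟩) < key (f.mapEdgeSet ⟨s(a', b'), hab'⟩) :=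
      hf _ _ hlt
    simp only [key] at h1
    rw [hpe a b hab ha, hpe a' b' hab' ha', Prod.Lex.toLex_lt_toLex] at h1
    rcases h1 with h1 | ⟨h1, h2⟩
    · exact Or.inl h1
    · exact Or.inr ⟨f.injective h1, h2⟩

/-- Each edge of `H` has an orientation that starts in `side`, so the lexicographic comparison
reaches every pair of edges. -/
theorem contains_of_hasLexCopy {V W : Type*} {H : EdgeOrderedGraph W} {k : ℕ} {pos : W → Fin k}
    {side : W → Prop} (hside : ∀ a b, H.graph.Adj a b → (side a ↔ ¬ side b))
    (hlex : ∀ a b a' b' (hab : H.graph.Adj a b) (hab' : H.graph.Adj a' b'), side a → side a' →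
        H.order.lt ⟨s(a, b), hab⟩ ⟨s(a', b'), hab'⟩ → pos a < pos a' ∨ a = a' ∧ pos b < pos b')
    {G : EdgeOrderedGraph V} {E : Finset (V × V)} (hE : ∀ e ∈ E, G.graph.Adj e.1 e.2)
    {r : V × V → ℕ} (hr : ∀ e e' (he : e ∈ E) (he' : e' ∈ E), r e < r e' →
      G.order.lt ⟨s(e.1, e.2), hE e he⟩ ⟨s(e'.1, e'.2), hE e' he'⟩)
    (hcopy : HasLexCopy H.graph side pos E r) : G.Contains H := by
  obtain ⟨φ, hφ, hφE, hφr⟩ := hcopy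
  have hrep : ∀ e : H.graph.edgeSet, ∃ (a b : W) (hab : H.graph.Adj a b), side a ∧
      e = ⟨s(a, b), hab⟩ := by
    rintro ⟨e, he⟩
    induction e with
    | _ a b =>
      have hab : H.graph.Adj a b := he
      by_cases ha : side a
      · exact ⟨a, b, hab, ha, rfl⟩
      · exact ⟨b, a, hab.symm, (hside b a hab.symm).2 ha, Subtype.ext Sym2.eq_swap⟩
  let f : SimpleGraph.Copy H.graph G.graph := ⟨⟨φ, by
    intro a b hab
    by_cases ha : side a
    · exact hE _ (hφE a b ha hab)
    · exact (hE _ (hφE b a ((hside b a hab.symm).2 ha) hab.symm)).symm⟩, hφ⟩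
  refine ⟨f, fun e e' hlt => ?_⟩
  obtain ⟨a, b, hab, ha, rfl⟩ := hrep e
  obtain ⟨a', b', hab', ha', rfl⟩ := hrep e'
  exact hr _ _ (hφE a b ha hab) (hφE a' b' ha' hab')
    (hφr a b a' b' ha ha' hab hab' (hlex a b a' b' hab hab' ha ha' hlt))

theorem exists_rank_of_linearOrder {α : Type*} [Finite α] (L : LinearOrder α) :
    ∃ ρ : α → ℕ, Injective ρ ∧ ∀ a b, ρ a < ρ b → L.lt a b := by
  have : Fintype α := Fintype.ofFinite _
  let ρ := (Fintype.orderIsoFinOfCardEq α rfl).symm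
  exact ⟨fun a => ρ a, Fin.val_injective.comp ρ.injective, fun a b h => ρ.lt_iff_lt.1 h⟩

/-- The rank of an edge in the edge-order. -/
theorem exists_rank {V : Type*} [Finite V] (G : EdgeOrderedGraph V) :
    ∃ r : V × V → ℕ, (∀ e, r e.swap = r e) ∧
      (∀ (e e' : V × V) (he : G.graph.Adj e.1 e.2) (he' : G.graph.Adj e'.1 e'.2), r e < r e' →
        G.order.lt ⟨s(e.1, e.2), he⟩ ⟨s(e'.1, e'.2), he'⟩) ∧
      ∀ e e' : V × V, G.graph.Adj e.1 e.2 → G.graph.Adj e'.1 e'.2 → r e = r e' →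
        s(e.1, e.2) = s(e'.1, e'.2) := by
  classical
  obtain ⟨ρ, hρ, hρlt⟩ := exists_rank_of_linearOrder G.order
  let r : V × V → ℕ := fun e =>
    if he : s(e.1, e.2) ∈ G.graph.edgeSet then ρ ⟨s(e.1, e.2), he⟩ else 0
  have hr : ∀ (e : V × V) (he : G.graph.Adj e.1 e.2), r e = ρ ⟨s(e.1, e.2), he⟩ :=
    fun e he => dif_pos he
  refine ⟨r, ?_, ?_, ?_⟩
  · rintro ⟨x, y⟩
    simp only [r, Prod.swap, Sym2.eq_swap (a := y) (b := x)]
  · intro e e' he he' hlt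
    rw [hr e he, hr e' he'] at hlt
    exact hρlt _ _ hlt
  · intro e e' he he' heq
    rw [hr e he, hr e' he'] at heq
    exact congrArg Subtype.val (hρ heq)

/-- The edge bound for edge-ordered graphs avoiding a forest embedded lexicographically. -/
theorem ncard_edgeSet_le_of_avoids {W : Type*} [Fintype W] {H : EdgeOrderedGraph W}
    (hH : H.graph.IsAcyclic) {k : ℕ} {pos : W → Fin k} (hpos : Injective pos)
    {side : W → Prop} (hside : ∀ a b, H.graph.Adj a b → (side a ↔ ¬ side b))
    (hlex : ∀ a b a' b' (hab : H.graph.Adj a b) (hab' : H.graph.Adj a' b'), side a → side a' →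
        H.order.lt ⟨s(a, b), hab⟩ ⟨s(a', b'), hab'⟩ → pos a < pos a' ∨ a = a' ∧ pos b < pos b')
    {n : ℕ} (hn : Fintype.card W ≤ n) {G : EdgeOrderedGraph (Fin n)} (hG : G.Avoids H) {t j : ℕ}
    (ht : 0 < t) (htj : n * n ≤ t ^ j) :
    G.graph.edgeSet.ncard ≤ (4 * k ^ 2 + 1) ^ j * ((2 * k + 1) * (2 * k * (2 * k + 1) *
      (Fintype.card W + k + 1) * t ^ (k + 1)) + 1) * (n + n) := by
  classical
  obtain ⟨r, hrs, hrlt, hreq⟩ := exists_rank G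
  -- Each edge is listed in one orientation only, which makes the symmetric rank `r` injective on
  -- `E`.
  let E : Finset (Fin n × Fin n) := {e | e.1 < e.2 ∧ G.graph.Adj e.1 e.2}
  have hE : ∀ e ∈ E, e.1 < e.2 ∧ G.graph.Adj e.1 e.2 := fun e he => (Finset.mem_filter.1 he).2
  have hEcard : G.graph.edgeSet.ncard ≤ #E := by
    have hsub : G.graph.edgeSet ⊆ (E.image fun e => s(e.1, e.2) : Finset (Sym2 (Fin n))) := by
      intro e he
      induction e with
      | _ x y =>
        have hxy : G.graph.Adj x y := he
        rw [Finset.mem_coe, Finset.mem_image]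
        rcases lt_or_gt_of_ne hxy.ne with hlt | hlt
        · exact ⟨(x, y), Finset.mem_filter.2 ⟨Finset.mem_univ _, hlt, hxy⟩, rfl⟩
        · exact ⟨(y, x), Finset.mem_filter.2 ⟨Finset.mem_univ _, hlt, hxy.symm⟩, Sym2.eq_swap⟩
    have h1 := Set.ncard_le_ncard hsub (Finset.finite_toSet _)
    rw [Set.ncard_coe_finset] at h1
    exact h1.trans Finset.card_image_le
  refine hEcard.trans ?_
  have hmain := card_le_of_not_hasLexCopy hH (side := side)
    (fun a b ha hb hab => (hside a b hab).1 ha hb) hpos (V := Fin n) (by simpa using hn)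
    (r := r) (h := Fintype.card W + k + 1) (Nat.lt_succ_self _) ht j E Finset.univ Finset.univ
    ?_ (fun e he => (hE e he).1.ne) (fun _ _ => Finset.mem_univ _) (fun _ _ => Finset.mem_univ _)
    ?_ ?_ ?_
  · simpa using hmain
  · intro e he e' he' heq
    obtain ⟨h1, h2⟩ := hE e he
    obtain ⟨h3, h4⟩ := hE e' he'
    rcases Sym2.eq_iff.1 (hreq e e' h2 h4 heq) with ⟨h5, h6⟩ | ⟨h5, h6⟩
    · exact Prod.ext h5 h6
    · rw [h5, h6] at h1
      exact absurd h3 h1.not_gt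
  · exact fun hcopy => hG (contains_of_hasLexCopy hside hlex (fun e he => (hE e he).2)
      (fun e e' he he' => hrlt e e' (hE e he).2 (hE e' he').2) hcopy)
  · intro hcopy
    have hE' : ∀ e ∈ E.image Prod.swap, G.graph.Adj e.1 e.2 := by
      intro e he
      obtain ⟨e', he', rfl⟩ := Finset.mem_image.1 he
      exact (hE e' he').2.symm
    refine hG (contains_of_hasLexCopy hside hlex hE' (fun e e' he he' hlt => ?_) hcopy)
    simp only [comp_apply, hrs] at hlt
    exact hrlt e e' (hE' e he) (hE' e' he') hlt
  · refine (Finset.card_le_univ E).trans (le_trans ?_ htj)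
    simp

end

end EdgeOrderedGraph

/-! ### Choice of parameters -/

theorem theorem1 {W : Type*} [Finite W] (H : EdgeOrderedGraph W)
    (hforest : H.graph.IsAcyclic) (hchrom : H.orderChromaticNumber = 2) :
    ∃ C : ℝ, 0 < C ∧ ∀ n : ℕ, 1 ≤ n →
      (EdgeOrderedGraph.turanNumber n H : ℝ) ≤
        (n : ℝ) * (2 : ℝ) ^ (C * Real.sqrt (Real.logb 2 (n : ℝ))) := by
  classical
  have : Fintype W := Fintype.ofFinite W
  obtain ⟨k, pos, side, hpos, hside, hlex⟩ :=
    EdgeOrderedGraph.exists_lex_of_orderChromaticNumber_eq_two hchrom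
  set w := Fintype.card W with hw
  set A := 4 * k ^ 2 + 1 with hA
  -- The summand `w` covers `n < w`, where the embedding argument lacks room and the trivial bound
  -- `n * n` is used.
  set B := (2 * k + 1) * (2 * k * (2 * k + 1) * (w + k + 1)) + w + 1 with hB
  have hnat : ∀ n s : ℕ, n * n ≤ (2 ^ s) ^ (2 * s) → ∀ G : EdgeOrderedGraph (Fin n), G.Avoids H →
      G.graph.edgeSet.ncard ≤ n * 2 ^ ((2 * A + k + 1) * s + (B + 1)) := by
    intro n s hns G hG
    have hA2 : A ≤ 2 ^ A := Nat.lt_two_pow_self.le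
    have hB2 : B ≤ 2 ^ B := Nat.lt_two_pow_self.le
    rcases lt_or_ge n w with hnw | hnw
    · have h1 : G.graph.edgeSet.ncard ≤ n * n := by
        have h2 : G.graph.edgeSet ⊆
            ((Finset.univ : Finset (Fin n × Fin n)).image fun e => s(e.1, e.2) :) := by
          intro e _
          induction e with
          | _ x y => simp
        have h3 := Set.ncard_le_ncard h2 (Finset.finite_toSet _)
        rw [Set.ncard_coe_finset] at h3
        refine (h3.trans Finset.card_image_le).trans ?_
        simp
      refine h1.trans (Nat.mul_le_mul_left n ?_)
      calc n ≤ B := by omega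
        _ ≤ 2 ^ B := hB2
        _ ≤ _ := Nat.pow_le_pow_right (by norm_num) (by omega)
    · refine (EdgeOrderedGraph.ncard_edgeSet_le_of_avoids hforest hpos hside hlex hnw hG
        (pow_pos two_pos s) hns).trans ?_
      have h1 : (2 * k + 1) * (2 * k * (2 * k + 1) * (w + k + 1) * (2 ^ s) ^ (k + 1)) + 1 ≤
          2 ^ B * (2 ^ s) ^ (k + 1) := by
        have hpos' : 1 ≤ (2 ^ s) ^ (k + 1) := Nat.one_le_pow _ _ (by positivity)
        calc _ ≤ B * (2 ^ s) ^ (k + 1) := by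
              rw [hB]
              nlinarith
          _ ≤ _ := Nat.mul_le_mul_right _ hB2
      calc _ ≤ (2 ^ A) ^ (2 * s) * (2 ^ B * (2 ^ s) ^ (k + 1)) * (n + n) := by
            gcongr
        _ = n * 2 ^ ((2 * A + k + 1) * s + (B + 1)) := by ring
  refine ⟨((2 * (2 * A + k + 1) + (B + 1) : ℕ) : ℝ), by positivity, fun n hn => ?_⟩
  set C : ℝ := ((2 * (2 * A + k + 1) + (B + 1) : ℕ) : ℝ) with hC
  have hbound : ∀ G : EdgeOrderedGraph (Fin n), G.Avoids H →
      (G.graph.edgeSet.ncard : ℝ) ≤ n * 2 ^ (C * Real.sqrt (Real.logb 2 n)) := by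
    intro G hG
    -- For `n = 1` the logarithm vanishes and cannot absorb additive constants, but there are no
    -- edges. For `n ≥ 2` it is at least 1, so rounding up at most doubles the square root.
    rcases hn.eq_or_lt with rfl | hn2
    · have : G.graph.edgeSet = ∅ := by
        have : G.graph = ⊥ := Subsingleton.elim _ _
        rw [this, SimpleGraph.edgeSet_bot]
      rw [this]
      simp
    · set L := Real.logb 2 (n : ℝ) with hL
      have hn0 : (0 : ℝ) < n := by exact_mod_cast (by omega : 0 < n)
      have hL1 : 1 ≤ L := by
        rw [hL, Real.le_logb_iff_rpow_le (by norm_num) hn0, Real.rpow_one]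
        exact_mod_cast hn2
      have hsq1 : 1 ≤ Real.sqrt L := Real.one_le_sqrt.2 hL1
      set s := ⌈Real.sqrt L⌉₊ with hs
      have hs1 : Real.sqrt L ≤ s := Nat.le_ceil _
      have hs2 : (s : ℝ) ≤ 2 * Real.sqrt L := by
        have := (Nat.ceil_lt_add_one (Real.sqrt_nonneg L)).le
        linarith
      have hns : n * n ≤ (2 ^ s) ^ (2 * s) := by
        have h1 : (n : ℝ) ≤ 2 ^ (s * s) := by
          rw [← Real.rpow_natCast, ← Real.logb_le_iff_le_rpow (by norm_num) hn0, ← hL]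
          push_cast
          calc L = Real.sqrt L * Real.sqrt L := (Real.mul_self_sqrt (by linarith)).symm
            _ ≤ s * s := by gcongr
        have h2 : n ≤ 2 ^ (s * s) := by exact_mod_cast h1
        calc n * n ≤ 2 ^ (s * s) * 2 ^ (s * s) := Nat.mul_le_mul h2 h2
          _ = _ := by ring
      have h1 := hnat n s hns G hG
      calc (G.graph.edgeSet.ncard : ℝ) ≤ n * 2 ^ ((2 * A + k + 1) * s + (B + 1)) := by
            exact_mod_cast h1
        _ ≤ n * 2 ^ (C * Real.sqrt L) := by
            rw [← Real.rpow_natCast 2 ((2 * A + k + 1) * s + (B + 1))]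
            gcongr
            · norm_num
            · rw [hC]
              push_cast
              have h2 : (2 * (A : ℝ) + k + 1) * s ≤ (2 * (A : ℝ) + k + 1) * (2 * Real.sqrt L) := by
                gcongr
              have h3 : ((B : ℝ) + 1) * 1 ≤ ((B : ℝ) + 1) * Real.sqrt L := by gcongr
              linarith
  have hmem := fun hne => Nat.sSup_mem (s := EdgeOrderedGraph.avoidingEdgeCounts n H) hne
    ⟨(Set.univ : Set (Sym2 (Fin n))).ncard, by
      rintro m ⟨G, -, rfl⟩
      exact Set.ncard_le_ncard (Set.subset_univ _) Set.finite_univ⟩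
  -- The supremum of the empty set is 0 by convention.
  rcases (EdgeOrderedGraph.avoidingEdgeCounts n H).eq_empty_or_nonempty with he | hne
  · rw [EdgeOrderedGraph.turanNumber, he]
    simp
    positivity
  · obtain ⟨G, hG, hm⟩ := hmem hne
    rw [EdgeOrderedGraph.turanNumber, hm]
    exact hbound G hG
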